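/- Let $H$ be a complex Hilbert space, let $\mathcal M\subset\mathcal B(H)$ be a von Neumann algebra with commutant $\mathcal M'$ and set of projections $\mathrm{Pr}(\mathcal M)$, and let $\tau:\mathcal M_+\to[0,\infty]$ be a faithful normal semifinite trace. For $a\in\mathcal B(H)$ let $s_\ell^{\mathcal M}(a)$ be the smallest projection $q\in\mathcal M$ with $qa=a$. A *quantum relation* on $\mathcal M$ is a weak*-closed $\mathcal M'$-$\mathcal M'$ bimodule $\mathcal V\subset\mathcal B(H)$. A *quantum coarse structure* on $\mathcal M$ is a family $\mathscr V$ of quantum relations on $\mathcal M$ such that (1) $\mathcal M'\in\mathscr V$; (2) every quantum relation contained in a member of $\mathscr V$ belongs to $\mathscr V$; (3) $\mathcal V\in\mathscr V$ implies $\mathcal V^*=\{a^*:a\in\mathcal V\}\in\mathscr V$; (4) $\mathcal V_1,\mathcal V_2\in\mathscr V$ implies $\overline{\mathcal V_1+\mathcal V_2}^{w^*}\in\mathscr V$; (5) $\mathcal V_1,\mathcal V_2\in\mathscr V$ implies $\overline{\mathrm{span}}^{w^*}(\mathcal V_1\mathcal V_2)\in\mathscr V$. It is *operator reflexive* if for every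 $\mathcal V\in\mathscr V$ the set $$\mathrm{orc}(\mathcal V)=\{a\in\mathcal B(H):\ \forall\, p,q\in\mathrm{Pr}(\mathcal B(H)),\ p\mathcal Vq=0\Rightarrow paq=0\}$$ belongs to $\mathscr V$. Its *algebraic quantum uniform Roe algebra* is $\mathrm C^*_u[\mathcal M,\mathscr V]=\bigcup_{\mathcal V\in\mathscr V}\mathcal V$. A map $\varphi:\mathrm{Pr}(\mathcal M)\to\mathrm{Pr}(\mathcal M)$ is *constrained* if there is $\lambda\ge0$ with $\tau(\varphi(q))\le\lambda\tau(q)$ for all $q\in\mathrm{Pr}(\mathcal M)$. Put $\mathcal V_\varphi=\{a\in\mathcal B(H): s_\ell^{\mathcal M}(aq)\le\varphi(q)\ \forall q\in\mathrm{Pr}(\mathcal M)\}$ and $\mathcal V_{\varphi,\psi}=\mathcal V_\varphi\cap(\mathcal V_\psi)^*$. Theorem. The family $\mathscr V_\tau$ of all quantum relations $\mathcal V$ on $\mathcal M$ for which there are constrained maps $\varphi,\psi:\mathrm{Pr}(\mathcal M)\to\mathrm{Pr}(\mathcal M)$ with $\mathcal V\subset\mathcal V_{\varphi,\psi}$ is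 an operator reflexive quantum coarse structure on $\mathcal M$. Moreover, $\mathrm C^*_u[\mathcal M,\mathscr V_\tau]$ is exactly the set of those $a\in\mathcal B(H)$ for which there is $\lambda\ge0$ with $$\tau(s_\ell^{\mathcal M}(aq))\le\lambda\,\tau(q)\quad\text{and}\quad\tau(s_\ell^{\mathcal M}(a^*q))\le\lambda\,\tau(q)\qquad\text{for all } q\in\mathrm{Pr}(\mathcal M).$$ -/

import Mathlib

open scoped NNReal ENNReal Pointwise

noncomputable section

namespace QuantumCoarse

variable {H : Type*} [NormedAddCommGroup H] [InnerProductSpace ℂ H] [CompleteSpace H]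

/-- The weak* (ultraweak) topology on `B(H)`: the coarsest topology for which all the functionals
`a ↦ ∑ ⟨η n, a (ξ n)⟩`, with `ξ` and `η` square summable sequences in `H`, are continuous. -/
abbrev weakStarTopology (H : Type*) [NormedAddCommGroup H] [InnerProductSpace ℂ H]
    [CompleteSpace H] : TopologicalSpace (H →L[ℂ] H) :=
  ⨅ (ξ : lp (fun _ : ℕ => H) 2) (η : lp (fun _ : ℕ => H) 2),
    TopologicalSpace.induced (fun a : H →L[ℂ] H => ∑' n, inner ℂ (η n) (a (ξ n))) inferInstance

/-- The weak* closure of a set of operators. -/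
def weakStarClosure (S : Set (H →L[ℂ] H)) : Set (H →L[ℂ] H) :=
  @closure (H →L[ℂ] H) (weakStarTopology H) S

/-- The set `Pr(M)` of projections of `M`, ordered as operators. -/
abbrev Proj (M : VonNeumannAlgebra H) : Type _ :=
  {p : H →L[ℂ] H // p ∈ M ∧ IsStarProjection p}

theorem exists_isLeast_proj (M : VonNeumannAlgebra H) (a : H →L[ℂ] H) :
    ∃ p : Proj M, IsLeast {q : Proj M | (q : H →L[ℂ] H) * a = a} p := by
  let K : Submodule ℂ H :=
    ⨅ q : {q : Proj M // (q : H →L[ℂ] H) * a = a}, ((1 : H →L[ℂ] H) - (q.1 : H →L[ℂ] H)).ker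
  have hK : ∀ v, v ∈ K ↔ ∀ q : Proj M, (q : H →L[ℂ] H) * a = a → (q : H →L[ℂ] H) v = v := by
    intro v
    simp [K, Submodule.mem_iInf, sub_eq_zero, eq_comm (a := v)]
  have hKc : IsClosed (K : Set H) := by
    simp only [K, Submodule.coe_iInf]
    exact isClosed_iInter fun q => ContinuousLinearMap.isClosed_ker _
  have : CompleteSpace K := hKc.completeSpace_coe
  have hP : IsStarProjection K.starProjection := isStarProjection_starProjection
  refine ⟨⟨K.starProjection, ?_, hP⟩, ?_, ?_⟩
  · rw [VonNeumannAlgebra.IsStarProjection.mem_iff hP]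
    intro y hy v hv
    rw [Submodule.range_starProjection] at hv
    rw [Submodule.mem_comap, Submodule.range_starProjection]
    refine (hK _).2 fun q hq => ?_
    have h := congrArg (fun f : H →L[ℂ] H => f v)
      (VonNeumannAlgebra.mem_commutant_iff.1 hy q q.2.1)
    simpa [(hK v).1 hv q hq] using h
  · ext ξ
    refine Submodule.starProjection_eq_self_iff.2 ((hK _).2 fun q hq => ?_)
    exact congrArg (fun f : H →L[ℂ] H => f ξ) hq
  · intro q hq
    refine (IsStarProjection.le_iff_mul_eq_right hP q.2.2).2 ?_
    ext v
    exact (hK _).1 (Submodule.starProjection_apply_mem K v) q hq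

/-- The left `M`-support of `a`: the smallest projection `q` in `M` with `q a = a`. -/
def leftSupport (M : VonNeumannAlgebra H) (a : H →L[ℂ] H) : Proj M :=
  (exists_isLeast_proj M a).choose

theorem isLeast_leftSupport (M : VonNeumannAlgebra H) (a : H →L[ℂ] H) :
    IsLeast {q : Proj M | (q : H →L[ℂ] H) * a = a} (leftSupport M a) :=
  (exists_isLeast_proj M a).choose_spec

/-- A quantum relation on `M`: a weak*-closed `M'`-`M'` bimodule in `B(H)`. (It is a complex
subspace, because `M'` contains the scalars.) -/
structure IsQuantumRelation (M : VonNeumannAlgebra H) (V : Set (H →L[ℂ] H)) : Prop where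
  zero_mem : (0 : H →L[ℂ] H) ∈ V
  add_mem : ∀ a ∈ V, ∀ b ∈ V, a + b ∈ V
  left_mem : ∀ m ∈ M.commutant, ∀ a ∈ V, m * a ∈ V
  right_mem : ∀ m ∈ M.commutant, ∀ a ∈ V, a * m ∈ V
  isClosed : @IsClosed (H →L[ℂ] H) (weakStarTopology H) V

/-- A quantum coarse structure on `M`. -/
structure IsQuantumCoarseStructure (M : VonNeumannAlgebra H)
    (F : Set (Set (H →L[ℂ] H))) : Prop where
  isQuantumRelation : ∀ V ∈ F, IsQuantumRelation M V
  commutant_mem : (M.commutant : Set (H →L[ℂ] H)) ∈ F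
  subset_mem : ∀ V₁ ∈ F, ∀ V₂, IsQuantumRelation M V₂ → V₂ ⊆ V₁ → V₂ ∈ F
  star_mem : ∀ V ∈ F, star V ∈ F
  add_mem : ∀ V₁ ∈ F, ∀ V₂ ∈ F, weakStarClosure (V₁ + V₂) ∈ F
  mul_mem : ∀ V₁ ∈ F, ∀ V₂ ∈ F,
    weakStarClosure (Submodule.span ℂ (V₁ * V₂) : Set (H →L[ℂ] H)) ∈ F

/-- The operator reflexive closure of a set of operators. -/
def orc (V : Set (H →L[ℂ] H)) : Set (H →L[ℂ] H) :=
  {a | ∀ p q : H →L[ℂ] H, IsStarProjection p → IsStarProjection q →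
    (∀ b ∈ V, p * b * q = 0) → p * a * q = 0}

/-- A family of quantum relations is operator reflexive if it is stable under operator reflexive
closures. -/
def IsOperatorReflexive (F : Set (Set (H →L[ℂ] H))) : Prop :=
  ∀ V ∈ F, orc V ∈ F

/-- The algebraic quantum uniform Roe algebra: the union of all the members. -/
def algRoe (F : Set (Set (H →L[ℂ] H))) : Set (H →L[ℂ] H) :=
  ⋃ V ∈ F, V

/-- The cone `M₊` of positive operators in `M`. -/
def posCone (M : VonNeumannAlgebra H) : Submodule ℝ≥0 (H →L[ℂ] H) where
  carrier := {x | x ∈ M ∧ 0 ≤ x}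
  zero_mem' := ⟨zero_mem M, le_rfl⟩
  add_mem' hx hy := ⟨add_mem hx.1 hy.1, add_nonneg hx.2 hy.2⟩
  smul_mem' c x hx := by
    refine ⟨?_, ?_⟩
    · have : c • x = ((c : ℝ) : ℂ) • x := by
        ext; simp [NNReal.smul_def]
      rw [this]
      exact M.toStarSubalgebra.smul_mem hx.1 _
    · exact smul_nonneg c.2 hx.2

theorem star_mul_self_mem_posCone {M : VonNeumannAlgebra H} {x : H →L[ℂ] H} (hx : x ∈ M) :
    star x * x ∈ posCone M :=
  ⟨mul_mem (star_mem hx) hx, star_mul_self_nonneg x⟩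

theorem mul_star_self_mem_posCone {M : VonNeumannAlgebra H} {x : H →L[ℂ] H} (hx : x ∈ M) :
    x * star x ∈ posCone M :=
  ⟨mul_mem hx (star_mem hx), mul_star_self_nonneg x⟩

/-- A projection of `M` as a positive element of `M`. -/
def Proj.toPos {M : VonNeumannAlgebra H} (p : Proj M) : posCone M :=
  ⟨p, p.2.1, p.2.2.nonneg⟩

/-- `τ : M₊ → [0, ∞]`, additive and positively homogeneous (with `0 * ∞ = 0`), is a faithful normal
semifinite trace. -/
structure IsFNSTrace (M : VonNeumannAlgebra H) (τ : posCone M →ₗ[ℝ≥0] ℝ≥0∞) : Prop where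
  tracial : ∀ (x : H →L[ℂ] H) (hx : x ∈ M),
    τ ⟨star x * x, star_mul_self_mem_posCone hx⟩ = τ ⟨x * star x, mul_star_self_mem_posCone hx⟩
  faithful : ∀ x, τ x = 0 → x = 0
  /-- `τ` preserves suprema of bounded upward directed families. -/
  normal : ∀ (S : Set (posCone M)) (x : posCone M), S.Nonempty → DirectedOn (· ≤ ·) S →
    IsLUB S x → IsLUB (τ '' S) (τ x)
  semifinite : ∀ x, x ≠ 0 → ∃ y, y ≤ x ∧ y ≠ 0 ∧ τ y < ∞

/-- A constrained map on `Pr(M)`. -/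
def IsConstrained {M : VonNeumannAlgebra H} (τ : posCone M →ₗ[ℝ≥0] ℝ≥0∞)
    (φ : Proj M → Proj M) : Prop :=
  ∃ c : ℝ≥0, ∀ q : Proj M, τ (φ q).toPos ≤ c * τ q.toPos

/-- The relation `V_φ` of a map `φ` on `Pr(M)`. -/
def relOf {M : VonNeumannAlgebra H} (φ : Proj M → Proj M) : Set (H →L[ℂ] H) :=
  {a | ∀ q : Proj M, leftSupport M (a * q) ≤ φ q}

/-- `V_{φ,ψ} = V_φ ∩ (V_ψ)^*`. -/
def relOf₂ {M : VonNeumannAlgebra H} (φ ψ : Proj M → Proj M) : Set (H →L[ℂ] H) :=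
  relOf φ ∩ star (relOf ψ)

/-- The family of the quantum relations contained in some `V_{φ,ψ}` with `φ`, `ψ` constrained. -/
def traceFamily (M : VonNeumannAlgebra H) (τ : posCone M →ₗ[ℝ≥0] ℝ≥0∞) :
    Set (Set (H →L[ℂ] H)) :=
  {V | IsQuantumRelation M V ∧
    ∃ φ ψ : Proj M → Proj M, IsConstrained τ φ ∧ IsConstrained τ ψ ∧ V ⊆ relOf₂ φ ψ}

end QuantumCoarse

end

open scoped NNReal ENNReal Pointwise Topology

set_option linter.unusedSectionVars false

noncomputable section

namespace QuantumCoarse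

variable {H : Type*} [NormedAddCommGroup H] [InnerProductSpace ℂ H] [CompleteSpace H]

/-! The condition `s_ℓ(aq) ≤ φ(q)` says `(1 - φ(q)) a q = 0`. Thus each `V_φ` is cut out by
equations `x a y = 0` with `x`, `y` in `M`. Such equations are linear and weak*-closed in `a`, are
stable under multiplying `a` by `M'` on either side, and pass to `orc`. So `V_φ` is a quantum
relation, and enlarging a relation by weak* closure, span or `orc` never leaves it; this settles
reflexivity with the same maps `φ`, `ψ`.

Products lead to composites of constrained maps, whose constants multiply. Sums need a constrained
map dominating two given ones, that is, a bound `τ(t) ≤ τ(p) + τ(q)` for some projection `t ≥ p, q`.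
This is the analytic core. With `x = (1 - q)p`, take `t = q + e`, where `e` is the range projection
of `xx*`. Traciality transports `1 - (1 - xx*)^n` to `1 - (1 - x*x)^n ≤ p`, and normality lets `n →
∞`, giving `τ(e) ≤ τ(p)`; no polar decomposition is needed.

For the Roe algebra, each `a` has least admissible maps, `q ↦ s_ℓ(aq)` and `q ↦ s_ℓ(a*q)`; the
stated inequalities say that these are constrained. -/

/-! ### The weak* topology -/

/-- The coordinatewise action of an operator on square summable sequences. -/
def mapSeq (a : H →L[ℂ] H) (ξ : lp (fun _ : ℕ => H) 2) : lp (fun _ : ℕ => H) 2 :=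
  ⟨fun n => a (ξ n), (lp.memℓp ξ).norm.const_mul ‖a‖ |>.mono fun n => by
    simpa using a.le_opNorm (ξ n)⟩

@[simp]
theorem mapSeq_apply (a : H →L[ℂ] H) (ξ : lp (fun _ : ℕ => H) 2) (n : ℕ) :
    mapSeq a ξ n = a (ξ n) := rfl

theorem weakStar_continuous_eval (ξ η : lp (fun _ : ℕ => H) 2) :
    Continuous[weakStarTopology H, inferInstance]
      (fun a : H →L[ℂ] H => ∑' n, inner ℂ (η n) (a (ξ n))) :=
  continuous_iInf_dom (i := ξ) (continuous_iInf_dom (i := η) continuous_induced_dom)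

theorem weakStar_continuous_iff {f : (H →L[ℂ] H) → (H →L[ℂ] H)} :
    Continuous[weakStarTopology H, weakStarTopology H] f ↔
      ∀ ξ η : lp (fun _ : ℕ => H) 2, Continuous[weakStarTopology H, inferInstance]
        (fun a : H →L[ℂ] H => ∑' n, inner ℂ (η n) (f a (ξ n))) := by
  rw [continuous_iInf_rng]
  refine forall_congr' fun ξ => ?_
  rw [continuous_iInf_rng]
  refine forall_congr' fun η => ?_
  rw [continuous_induced_rng]
  rfl

theorem weakStar_continuous_mul_left (m : H →L[ℂ] H) :
    Continuous[weakStarTopology H, weakStarTopology H] (fun a : H →L[ℂ] H => m * a) := by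
  refine weakStar_continuous_iff.2 fun ξ η => ?_
  simpa [ContinuousLinearMap.adjoint_inner_left] using
    weakStar_continuous_eval ξ (mapSeq (ContinuousLinearMap.adjoint m) η)

theorem weakStar_continuous_mul_right (m : H →L[ℂ] H) :
    Continuous[weakStarTopology H, weakStarTopology H] (fun a : H →L[ℂ] H => a * m) := by
  refine weakStar_continuous_iff.2 fun ξ η => ?_
  simpa using weakStar_continuous_eval (mapSeq m ξ) η

theorem weakStar_continuous_add_right (b : H →L[ℂ] H) :
    Continuous[weakStarTopology H, weakStarTopology H] (fun a : H →L[ℂ] H => a + b) := by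
  refine weakStar_continuous_iff.2 fun ξ η => ?_
  let := weakStarTopology H
  refine ((weakStar_continuous_eval ξ η).add
    (continuous_const (y := ∑' n, inner ℂ (η n) (b (ξ n))))).congr fun a => ?_
  have ha : Summable fun n => inner ℂ (η n) (a (ξ n)) := lp.summable_inner η (mapSeq a ξ)
  have hb : Summable fun n => inner ℂ (η n) (b (ξ n)) := lp.summable_inner η (mapSeq b ξ)
  simp [ha.tsum_add hb]

theorem weakStar_continuous_star :
    Continuous[weakStarTopology H, weakStarTopology H] (fun a : H →L[ℂ] H => star a) := by
  refine weakStar_continuous_iff.2 fun ξ η => ?_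
  let := weakStarTopology H
  refine (continuous_star.comp (weakStar_continuous_eval η ξ)).congr fun a => ?_
  simp [Complex.conj_tsum, ContinuousLinearMap.star_eq_adjoint, ContinuousLinearMap.adjoint_inner_right]

/-- Sequences supported at one index recover matrix coefficients, so the weak* topology refines the
weak operator topology. -/
theorem weakStar_continuous_inner (v w : H) :
    Continuous[weakStarTopology H, inferInstance]
      (fun a : H →L[ℂ] H => inner ℂ w (a v)) := by
  have h := weakStar_continuous_eval (lp.single 2 0 v) (lp.single 2 0 w)
  convert h using 2 with a
  rw [tsum_eq_single 0 fun n hn => by simp [hn]]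
  simp

theorem weakStar_isClosed_mul_mul_eq_zero (x y : H →L[ℂ] H) :
    @IsClosed (H →L[ℂ] H) (weakStarTopology H) {a | x * a * y = 0} := by
  let := weakStarTopology H
  have h : {a : H →L[ℂ] H | x * a * y = 0} =
      ⋂ (v : H) (w : H), {a | inner ℂ w ((x * a * y) v) = 0} := by
    ext a
    simp only [Set.mem_ofPred_eq, Set.mem_iInter]
    refine ⟨fun h v w => by simp [h], fun h => ?_⟩
    ext v
    exact inner_self_eq_zero.1 (h v _)
  rw [h]
  exact isClosed_iInter fun v => isClosed_iInter fun w => isClosed_eq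
    ((weakStar_continuous_inner v w).comp
      ((weakStar_continuous_mul_right y).comp (weakStar_continuous_mul_left x))) continuous_const

theorem subset_weakStarClosure (S : Set (H →L[ℂ] H)) : S ⊆ weakStarClosure S :=
  @subset_closure _ (weakStarTopology H) S

theorem weakStarClosure_subset {S T : Set (H →L[ℂ] H)} (h : S ⊆ T)
    (hT : @IsClosed (H →L[ℂ] H) (weakStarTopology H) T) : weakStarClosure S ⊆ T :=
  @closure_minimal _ (weakStarTopology H) _ _ h hT

/-- Algebraic closure properties pass to weak* closures one variable at a time, so separate
continuity of the operations is enough. -/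
theorem map_mem_weakStarClosure {f : (H →L[ℂ] H) → (H →L[ℂ] H)}
    (hf : Continuous[weakStarTopology H, weakStarTopology H] f) {S T : Set (H →L[ℂ] H)}
    (h : ∀ a ∈ S, f a ∈ weakStarClosure T) {a : H →L[ℂ] H} (ha : a ∈ weakStarClosure S) :
    f a ∈ weakStarClosure T := by
  let := weakStarTopology H
  exact weakStarClosure_subset (T := f ⁻¹' weakStarClosure T) h (isClosed_closure.preimage hf) ha

/-! ### Quantum relations -/

/-- The weak* closure of an `M'`-`M'` bimodule is a quantum relation. -/
theorem isQuantumRelation_weakStarClosure {M : VonNeumannAlgebra H} {S : Set (H →L[ℂ] H)}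
    (zero : 0 ∈ S) (add : ∀ a ∈ S, ∀ b ∈ S, a + b ∈ S)
    (left : ∀ m ∈ M.commutant, ∀ a ∈ S, m * a ∈ S)
    (right : ∀ m ∈ M.commutant, ∀ a ∈ S, a * m ∈ S) :
    IsQuantumRelation M (weakStarClosure S) where
  zero_mem := subset_weakStarClosure S zero
  add_mem a ha b hb := by
    refine map_mem_weakStarClosure (weakStar_continuous_add_right b) (fun a ha => ?_) ha
    rw [add_comm]
    refine map_mem_weakStarClosure (weakStar_continuous_add_right a) (fun b hb => ?_) hb
    exact subset_weakStarClosure S (add b hb a ha)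
  left_mem m hm a ha := map_mem_weakStarClosure (weakStar_continuous_mul_left m)
    (fun a ha => subset_weakStarClosure S (left m hm a ha)) ha
  right_mem m hm a ha := map_mem_weakStarClosure (weakStar_continuous_mul_right m)
    (fun a ha => subset_weakStarClosure S (right m hm a ha)) ha
  isClosed := @isClosed_closure _ (weakStarTopology H) S

theorem IsQuantumRelation.star {M : VonNeumannAlgebra H} {V : Set (H →L[ℂ] H)}
    (hV : IsQuantumRelation M V) : IsQuantumRelation M (star V) where
  zero_mem := by simpa using hV.zero_mem
  add_mem a ha b hb := by simpa using hV.add_mem _ ha _ hb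
  left_mem m hm a ha := by simpa using hV.right_mem _ (star_mem hm) _ ha
  right_mem m hm a ha := by simpa using hV.left_mem _ (star_mem hm) _ ha
  isClosed := by
    let := weakStarTopology H
    exact hV.isClosed.preimage weakStar_continuous_star

theorem IsQuantumRelation.inter {M : VonNeumannAlgebra H} {V W : Set (H →L[ℂ] H)}
    (hV : IsQuantumRelation M V) (hW : IsQuantumRelation M W) : IsQuantumRelation M (V ∩ W) where
  zero_mem := ⟨hV.zero_mem, hW.zero_mem⟩
  add_mem a ha b hb := ⟨hV.add_mem a ha.1 b hb.1, hW.add_mem a ha.2 b hb.2⟩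
  left_mem m hm a ha := ⟨hV.left_mem m hm a ha.1, hW.left_mem m hm a ha.2⟩
  right_mem m hm a ha := ⟨hV.right_mem m hm a ha.1, hW.right_mem m hm a ha.2⟩
  isClosed := by
    let := weakStarTopology H
    exact hV.isClosed.inter hW.isClosed

theorem smul_one_mem (M : VonNeumannAlgebra H) (c : ℂ) : c • (1 : H →L[ℂ] H) ∈ M :=
  M.toStarSubalgebra.smul_mem (one_mem M.toStarSubalgebra) c

theorem IsQuantumRelation.smul_mem {M : VonNeumannAlgebra H} {V : Set (H →L[ℂ] H)}
    (hV : IsQuantumRelation M V) (c : ℂ) {a : H →L[ℂ] H} (ha : a ∈ V) : c • a ∈ V := by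
  simpa using hV.left_mem _ (smul_one_mem M.commutant c) a ha

/-- A quantum relation as a complex subspace of `B(H)`. -/
def IsQuantumRelation.toSubmodule {M : VonNeumannAlgebra H} {V : Set (H →L[ℂ] H)}
    (hV : IsQuantumRelation M V) : Submodule ℂ (H →L[ℂ] H) where
  carrier := V
  zero_mem' := hV.zero_mem
  add_mem' ha hb := hV.add_mem _ ha _ hb
  smul_mem' c _ ha := hV.smul_mem c ha

theorem isQuantumRelation_commutant (M : VonNeumannAlgebra H) :
    IsQuantumRelation M (M.commutant : Set (H →L[ℂ] H)) where
  zero_mem := zero_mem M.commutant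
  add_mem a ha b hb := add_mem (S := VonNeumannAlgebra H) ha hb
  left_mem m hm a ha := mul_mem (S := VonNeumannAlgebra H) hm ha
  right_mem m hm a ha := mul_mem (S := VonNeumannAlgebra H) ha hm
  isClosed := by
    let := weakStarTopology H
    have h : (M.commutant : Set (H →L[ℂ] H)) = ⋂ (x : M) (v : H) (w : H),
        {a | inner ℂ w (((x : H →L[ℂ] H) * a) v) = inner ℂ w ((a * (x : H →L[ℂ] H)) v)} := by
      ext a
      simp only [SetLike.mem_coe, VonNeumannAlgebra.mem_commutant_iff, Set.mem_ofPred_eq,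
        Set.mem_iInter]
      refine ⟨fun h x v w => by rw [h x x.2], fun h x hx => ?_⟩
      ext v
      exact ext_inner_left ℂ (h ⟨x, hx⟩ v)
    rw [h]
    exact isClosed_iInter fun x => isClosed_iInter fun v => isClosed_iInter fun w => isClosed_eq
      ((weakStar_continuous_inner v w).comp (weakStar_continuous_mul_left (x : H →L[ℂ] H)))
      ((weakStar_continuous_inner v w).comp (weakStar_continuous_mul_right (x : H →L[ℂ] H)))

theorem isQuantumRelation_add {M : VonNeumannAlgebra H} {V W : Set (H →L[ℂ] H)}
    (hV : IsQuantumRelation M V) (hW : IsQuantumRelation M W) :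
    IsQuantumRelation M (weakStarClosure (V + W)) := by
  refine isQuantumRelation_weakStarClosure ?_ ?_ ?_ ?_
  · exact ⟨0, hV.zero_mem, 0, hW.zero_mem, add_zero 0⟩
  · rintro _ ⟨a, ha, b, hb, rfl⟩ _ ⟨c, hc, d, hd, rfl⟩
    exact ⟨a + c, hV.add_mem a ha c hc, b + d, hW.add_mem b hb d hd, add_add_add_comm a c b d⟩
  · rintro m hm _ ⟨a, ha, b, hb, rfl⟩
    exact ⟨m * a, hV.left_mem m hm a ha, m * b, hW.left_mem m hm b hb, (mul_add m a b).symm⟩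
  · rintro m hm _ ⟨a, ha, b, hb, rfl⟩
    exact ⟨a * m, hV.right_mem m hm a ha, b * m, hW.right_mem m hm b hb, (add_mul a b m).symm⟩

theorem isQuantumRelation_mul {M : VonNeumannAlgebra H} {V W : Set (H →L[ℂ] H)}
    (hV : IsQuantumRelation M V) (hW : IsQuantumRelation M W) :
    IsQuantumRelation M (weakStarClosure (Submodule.span ℂ (V * W) : Set (H →L[ℂ] H))) := by
  refine isQuantumRelation_weakStarClosure (Submodule.zero_mem _)
    (fun a ha b hb => Submodule.add_mem _ ha hb) (fun m hm a ha => ?_) (fun m hm a ha => ?_)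
  · have h : Submodule.span ℂ (V * W) ≤
        (Submodule.span ℂ (V * W)).comap (LinearMap.mulLeft ℂ m) := by
      refine Submodule.span_le.2 ?_
      rintro _ ⟨a, ha, b, hb, rfl⟩
      refine Submodule.subset_span ⟨m * a, hV.left_mem m hm a ha, b, hb, ?_⟩
      simp [mul_assoc]
    exact h ha
  · have h : Submodule.span ℂ (V * W) ≤
        (Submodule.span ℂ (V * W)).comap (LinearMap.mulRight ℂ m) := by
      refine Submodule.span_le.2 ?_
      rintro _ ⟨a, ha, b, hb, rfl⟩
      refine Submodule.subset_span ⟨a, ha, b * m, hW.right_mem m hm b hb, ?_⟩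
      simp [mul_assoc]
    exact h ha

/-! ### Range projections and operator reflexive closures -/

/-- The projection onto the closure of the range of an operator. -/
def rangeProj (a : H →L[ℂ] H) : H →L[ℂ] H :=
  a.range.topologicalClosure.starProjection

theorem isStarProjection_rangeProj (a : H →L[ℂ] H) : IsStarProjection (rangeProj a) :=
  isStarProjection_starProjection

theorem rangeProj_apply_mem_closure (a : H →L[ℂ] H) (v : H) :
    rangeProj a v ∈ closure (Set.range a) :=
  Submodule.starProjection_apply_mem a.range.topologicalClosure v

theorem rangeProj_mul_self (a : H →L[ℂ] H) : rangeProj a * a = a := by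
  ext v
  exact Submodule.starProjection_eq_self_iff.2
    (Submodule.le_topologicalClosure _ (LinearMap.mem_range_self _ v))

/-- The range of `c` lies in `ker x`, the orthogonal complement of the range of `x*`. -/
theorem rangeProj_star_mul_eq_zero {x c : H →L[ℂ] H} (h : x * c = 0) :
    rangeProj (star x) * c = 0 := by
  ext v
  refine (Submodule.starProjection_apply_eq_zero_iff _).2 ?_
  rw [Submodule.orthogonal_closure, Submodule.mem_orthogonal]
  rintro _ ⟨u, rfl⟩
  have hv : x (c v) = 0 := congrArg (fun f : H →L[ℂ] H => f v) h
  simp [ContinuousLinearMap.star_eq_adjoint, ContinuousLinearMap.adjoint_inner_left, hv]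

theorem mul_rangeProj_star (x : H →L[ℂ] H) : x * rangeProj (star x) = x := by
  simpa [(isStarProjection_rangeProj _).isSelfAdjoint.star_eq] using
    congrArg star (rangeProj_mul_self (star x))

theorem rangeProj_mem {M : VonNeumannAlgebra H} {a : H →L[ℂ] H} (ha : a ∈ M) :
    rangeProj a ∈ M := by
  rw [VonNeumannAlgebra.IsStarProjection.mem_iff (isStarProjection_rangeProj a)]
  intro y hy v hv
  rw [rangeProj, Submodule.range_starProjection] at hv
  rw [Submodule.mem_comap, rangeProj, Submodule.range_starProjection]
  refine map_mem_closure (f := y) y.continuous hv ?_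
  rintro _ ⟨u, rfl⟩
  exact ⟨y u, congrArg (fun f : H →L[ℂ] H => f u) (VonNeumannAlgebra.mem_commutant_iff.1 hy a ha)⟩

/-- If `a` lies in the operator reflexive closure of `V`, then `x V y = 0` implies `x a y = 0` for
arbitrary operators `x`, `y`. -/
theorem mul_mul_eq_zero_of_mem_orc {V : Set (H →L[ℂ] H)} {a : H →L[ℂ] H} (ha : a ∈ orc V)
    {x y : H →L[ℂ] H} (h : ∀ b ∈ V, x * b * y = 0) : x * a * y = 0 := by
  -- Replace `x` by its right support and `y` by its left support: these are projections, and they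
  -- annihilate the same middle factors.
  have key : rangeProj (star x) * a * rangeProj y = 0 := by
    refine ha _ _ (isStarProjection_rangeProj _) (isStarProjection_rangeProj _) fun b hb => ?_
    have h₁ : rangeProj (star x) * (b * y) = 0 :=
      rangeProj_star_mul_eq_zero (by rw [← mul_assoc]; exact h b hb)
    have h₂ : star y * (star b * rangeProj (star x)) = 0 := by
      simpa [(isStarProjection_rangeProj (star x)).isSelfAdjoint.star_eq, mul_assoc]
        using congrArg star h₁
    have h₃ := rangeProj_star_mul_eq_zero h₂
    simpa [(isStarProjection_rangeProj _).isSelfAdjoint.star_eq, mul_assoc] using congrArg star h₃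
  calc x * a * y = x * rangeProj (star x) * a * (rangeProj y * y) := by
        rw [mul_rangeProj_star, rangeProj_mul_self]
    _ = x * (rangeProj (star x) * a * rangeProj y) * y := by simp only [mul_assoc]
    _ = 0 := by rw [key]; simp

theorem isQuantumRelation_orc {M : VonNeumannAlgebra H} {V : Set (H →L[ℂ] H)}
    (hV : IsQuantumRelation M V) : IsQuantumRelation M (orc V) where
  zero_mem p q _ _ _ := by simp
  add_mem a ha b hb p q hp hq h := by
    rw [mul_add, add_mul, ha p q hp hq h, hb p q hp hq h, add_zero]
  left_mem m hm a ha p q hp hq h := by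
    rw [← mul_assoc]
    -- The factor `p m` need not be a projection, hence the version of `orc` with arbitrary
    -- operators.
    refine mul_mul_eq_zero_of_mem_orc ha fun b hb => ?_
    simpa only [mul_assoc] using h _ (hV.left_mem m hm b hb)
  right_mem m hm a ha p q hp hq h := by
    rw [← mul_assoc, mul_assoc]
    refine mul_mul_eq_zero_of_mem_orc ha fun b hb => ?_
    simpa only [mul_assoc] using h _ (hV.right_mem m hm b hb)
  isClosed := by
    let := weakStarTopology H
    have h : orc V = ⋂ (p : H →L[ℂ] H) (q : H →L[ℂ] H) (_ : IsStarProjection p)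
        (_ : IsStarProjection q) (_ : ∀ b ∈ V, p * b * q = 0), {a | p * a * q = 0} := by
      ext a
      simp [orc]
    rw [h]
    exact isClosed_iInter fun p => isClosed_iInter fun q => isClosed_iInter fun _ =>
      isClosed_iInter fun _ => isClosed_iInter fun _ => weakStar_isClosed_mul_mul_eq_zero p q

/-! ### The relations `V_φ` -/

theorem leftSupport_le_iff {M : VonNeumannAlgebra H} {a : H →L[ℂ] H} {p : Proj M} :
    leftSupport M a ≤ p ↔ (p : H →L[ℂ] H) * a = a := by
  refine ⟨fun h => ?_, fun h => (isLeast_leftSupport M a).2 h⟩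
  have h₁ := (IsStarProjection.le_iff_mul_eq_right (leftSupport M a).2.2 p.2.2).1 h
  have h₂ : (leftSupport M a : H →L[ℂ] H) * a = a := (isLeast_leftSupport M a).1
  rw [← h₂, ← mul_assoc, h₁]

/-- Turns an order condition on supports into equations `x a y = 0`, which survive weak* limits and
operator reflexive closure. -/
theorem mem_relOf_iff {M : VonNeumannAlgebra H} {φ : Proj M → Proj M} {a : H →L[ℂ] H} :
    a ∈ relOf φ ↔ ∀ q : Proj M, (1 - (φ q : H →L[ℂ] H)) * a * q = 0 := by
  refine forall_congr' fun q => ?_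
  rw [leftSupport_le_iff, mul_assoc, sub_mul, one_mul, sub_eq_zero, eq_comm]

theorem orc_relOf {M : VonNeumannAlgebra H} {φ : Proj M → Proj M} {V : Set (H →L[ℂ] H)}
    (h : V ⊆ relOf φ) : orc V ⊆ relOf φ := fun _ ha => mem_relOf_iff.2 fun q =>
  mul_mul_eq_zero_of_mem_orc ha fun _ hb => mem_relOf_iff.1 (h hb) q

theorem star_orc (V : Set (H →L[ℂ] H)) : star (orc V) ⊆ orc (star V) := by
  intro a ha p q hp hq h
  have := ha q p hq hp fun b hb => by
    have := h (star b) (by simpa using hb)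
    simpa [hp.isSelfAdjoint.star_eq, hq.isSelfAdjoint.star_eq, mul_assoc] using congrArg star this
  simpa [hp.isSelfAdjoint.star_eq, hq.isSelfAdjoint.star_eq, mul_assoc] using congrArg star this

theorem isQuantumRelation_relOf {M : VonNeumannAlgebra H} (φ : Proj M → Proj M) :
    IsQuantumRelation M (relOf φ) where
  zero_mem := mem_relOf_iff.2 fun q => by simp
  add_mem a ha b hb := mem_relOf_iff.2 fun q => by
    rw [mul_add, add_mul, mem_relOf_iff.1 ha q, mem_relOf_iff.1 hb q, add_zero]
  left_mem m hm a ha q := by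
    rw [leftSupport_le_iff, mul_assoc, ← mul_assoc,
      VonNeumannAlgebra.mem_commutant_iff.1 hm _ (φ q).2.1, mul_assoc, leftSupport_le_iff.1 (ha q)]
  right_mem m hm a ha q := by
    rw [leftSupport_le_iff, mul_assoc, ← VonNeumannAlgebra.mem_commutant_iff.1 hm _ q.2.1,
      ← mul_assoc, ← mul_assoc, ← mul_assoc, mul_assoc _ a, leftSupport_le_iff.1 (ha q)]
  isClosed := by
    let := weakStarTopology H
    have h : relOf φ = ⋂ q : Proj M, {a | (1 - (φ q : H →L[ℂ] H)) * a * q = 0} := by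
      ext a
      simp [mem_relOf_iff]
    rw [h]
    exact isClosed_iInter fun q => weakStar_isClosed_mul_mul_eq_zero _ _

theorem isQuantumRelation_relOf₂ {M : VonNeumannAlgebra H} (φ ψ : Proj M → Proj M) :
    IsQuantumRelation M (relOf₂ φ ψ) :=
  (isQuantumRelation_relOf φ).inter (isQuantumRelation_relOf ψ).star

theorem relOf_mono {M : VonNeumannAlgebra H} {φ φ' : Proj M → Proj M} (h : ∀ q, φ q ≤ φ' q) :
    relOf φ ⊆ relOf φ' := fun _ ha q => (ha q).trans (h q)

theorem mul_mem_relOf {M : VonNeumannAlgebra H} {φ φ' : Proj M → Proj M} {a b : H →L[ℂ] H}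
    (ha : a ∈ relOf φ) (hb : b ∈ relOf φ') : a * b ∈ relOf (φ ∘ φ') := by
  intro q
  have h₁ := leftSupport_le_iff.1 (hb q)
  have h₂ := leftSupport_le_iff.1 (ha (φ' q))
  rw [leftSupport_le_iff, mul_assoc a, ← h₁, ← mul_assoc a, ← mul_assoc, Function.comp_apply, h₂]

theorem commutant_subset_relOf_id (M : VonNeumannAlgebra H) :
    (M.commutant : Set (H →L[ℂ] H)) ⊆ relOf (id : Proj M → Proj M) := by
  intro m hm q
  have hm : (q : H →L[ℂ] H) * m = m * q := VonNeumannAlgebra.mem_commutant_iff.1 hm _ q.2.1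
  rw [leftSupport_le_iff, id, ← hm, ← mul_assoc, q.2.2.isIdempotentElem.eq]

/-! ### Approximation of the range projection -/

/-- For `0 ≤ y ≤ 1`, the operators `1 - (1 - y) ^ n` increase to the range projection of `y`. -/
def rangeApprox (y : H →L[ℂ] H) (n : ℕ) : H →L[ℂ] H := 1 - (1 - y) ^ n

theorem rangeApprox_eq_mul_sum (y : H →L[ℂ] H) (n : ℕ) :
    rangeApprox y n = y * ∑ k ∈ Finset.range n, (1 - y) ^ k := by
  simpa [rangeApprox] using (mul_neg_geom_sum (1 - y) n).symm

theorem rangeApprox_mono {y : H →L[ℂ] H} (h₀ : 0 ≤ y) (h₁ : y ≤ 1) : Monotone (rangeApprox y) :=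
  fun _ _ h => sub_le_sub_left
    (CStarAlgebra.pow_antitone (sub_nonneg.2 h₁) (sub_le_self 1 h₀) h) 1

theorem rangeApprox_nonneg {y : H →L[ℂ] H} (h₀ : 0 ≤ y) (h₁ : y ≤ 1) (n : ℕ) :
    0 ≤ rangeApprox y n := by
  simpa [rangeApprox] using rangeApprox_mono h₀ h₁ (Nat.zero_le n)

theorem rangeApprox_le_one {y : H →L[ℂ] H} (h₁ : y ≤ 1) (n : ℕ) : rangeApprox y n ≤ 1 :=
  sub_le_self 1 (CStarAlgebra.pow_nonneg (sub_nonneg.2 h₁) n)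

theorem norm_one_sub_pow_le {y : H →L[ℂ] H} (h₀ : 0 ≤ y) (h₁ : y ≤ 1) (n : ℕ) :
    ‖(1 - y) ^ n‖ ≤ 1 := by
  refine (CStarAlgebra.norm_le_one_iff_of_nonneg _
    (CStarAlgebra.pow_nonneg (sub_nonneg.2 h₁) n)).2 ?_
  simpa using CStarAlgebra.pow_antitone (sub_nonneg.2 h₁) (sub_le_self 1 h₀) (Nat.zero_le n)

theorem commute_one_sub_pow (y : H →L[ℂ] H) (n : ℕ) : Commute y ((1 - y) ^ n) :=
  ((Commute.one_right y).sub_right (Commute.refl y)).pow_right n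

theorem mul_one_sub_pow_nonneg {y : H →L[ℂ] H} (h₀ : 0 ≤ y) (h₁ : y ≤ 1) (n : ℕ) :
    0 ≤ y * (1 - y) ^ n :=
  (commute_one_sub_pow y n).mul_nonneg h₀ (CStarAlgebra.pow_nonneg (sub_nonneg.2 h₁) n)

/-- The terms `y (1 - y)^k` decrease in `k`, so `n` copies of the `n`-th are at most the geometric
sum over `k < n`, which is `1 - (1 - y)^n ≤ 1`. -/
theorem norm_mul_one_sub_pow_le {y : H →L[ℂ] H} (h₀ : 0 ≤ y) (h₁ : y ≤ 1) (n : ℕ) :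
    (n : ℝ) * ‖y * (1 - y) ^ n‖ ≤ 1 := by
  have h : n • (y * (1 - y) ^ n) ≤ 1 := by
    calc n • (y * (1 - y) ^ n) = ∑ k ∈ Finset.range n, y * (1 - y) ^ n := by simp
      _ ≤ ∑ k ∈ Finset.range n, y * (1 - y) ^ k := by
        refine Finset.sum_le_sum fun k hk => ?_
        rw [← sub_nonneg, ← mul_sub]
        refine ((commute_one_sub_pow y k).sub_right (commute_one_sub_pow y n)).mul_nonneg h₀ ?_
        exact sub_nonneg.2 (CStarAlgebra.pow_antitone (sub_nonneg.2 h₁) (sub_le_self 1 h₀)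
          (Finset.mem_range.1 hk).le)
      _ = rangeApprox y n := by rw [rangeApprox_eq_mul_sum, Finset.mul_sum]
      _ ≤ 1 := rangeApprox_le_one h₁ n
  have := (CStarAlgebra.norm_le_one_iff_of_nonneg _
    (nsmul_nonneg (mul_one_sub_pow_nonneg h₀ h₁ n) n)).2 h
  rwa [← Nat.cast_smul_eq_nsmul ℝ, norm_smul, Real.norm_natCast] at this

/-- On the range of `y` the decay is of order `1/n`; the uniform bound `‖(1 - y)^n‖ ≤ 1` extends the
convergence to the closure. -/
theorem tendsto_one_sub_pow_apply {y : H →L[ℂ] H} (h₀ : 0 ≤ y) (h₁ : y ≤ 1) {w : H}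
    (hw : w ∈ closure (Set.range y)) :
    Filter.Tendsto (fun n : ℕ => ((1 - y) ^ n : H →L[ℂ] H) w) Filter.atTop (𝓝 0) := by
  rw [Metric.tendsto_atTop]
  intro ε hε
  obtain ⟨_, ⟨u, rfl⟩, hu⟩ := Metric.mem_closure_iff.1 hw (ε / 2) (half_pos hε)
  obtain ⟨N, hN⟩ := exists_nat_gt (2 * ‖u‖ / ε)
  refine ⟨N + 1, fun n hn => ?_⟩
  have hn' : (0 : ℝ) < n := by exact_mod_cast (Nat.succ_pos N).trans_le hn
  have hN' : 2 * ‖u‖ / ε < n := hN.trans (by exact_mod_cast hn)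
  have e₁ : ‖((1 - y) ^ n) (w - y u)‖ < ε / 2 := by
    refine (((1 - y) ^ n).le_of_opNorm_le (norm_one_sub_pow_le h₀ h₁ n) _).trans_lt ?_
    rwa [one_mul, ← dist_eq_norm]
  have e₂ : ‖((1 - y) ^ n) (y u)‖ ≤ ε / 2 := by
    have e : ((1 - y) ^ n) (y u) = (y * (1 - y) ^ n) u := by
      rw [(commute_one_sub_pow y n).eq]; rfl
    rw [e]
    have h := norm_mul_one_sub_pow_le h₀ h₁ n
    have h' := (y * (1 - y) ^ n).le_opNorm u
    rw [div_lt_iff₀ hε] at hN'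
    have h'' : (n : ℝ) * ‖(y * (1 - y) ^ n) u‖ ≤ n * (ε / 2) := by
      calc (n : ℝ) * ‖(y * (1 - y) ^ n) u‖ ≤ n * (‖y * (1 - y) ^ n‖ * ‖u‖) := by gcongr
        _ = (n * ‖y * (1 - y) ^ n‖) * ‖u‖ := by ring
        _ ≤ 1 * ‖u‖ := by gcongr
        _ ≤ n * (ε / 2) := by linarith
    exact le_of_mul_le_mul_left h'' hn'
  calc dist (((1 - y) ^ n) w) 0 = ‖((1 - y) ^ n) (w - y u) + ((1 - y) ^ n) (y u)‖ := by
        rw [← map_add, sub_add_cancel, dist_zero_right]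
    _ ≤ _ := norm_add_le _ _
    _ < ε := by linarith

theorem mul_rangeProj_of_nonneg {y : H →L[ℂ] H} (h₀ : 0 ≤ y) : y * rangeProj y = y := by
  simpa [(IsSelfAdjoint.of_nonneg h₀).star_eq] using mul_rangeProj_star y

theorem rangeApprox_mul_rangeProj {y : H →L[ℂ] H} (h₀ : 0 ≤ y) (n : ℕ) :
    rangeApprox y n * rangeProj y = rangeApprox y n := by
  have h : Commute y (∑ k ∈ Finset.range n, (1 - y) ^ k) :=
    Commute.sum_right _ _ _ fun k _ => commute_one_sub_pow y k
  rw [rangeApprox_eq_mul_sum, h.eq, mul_assoc, mul_rangeProj_of_nonneg h₀]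

/-- With `r` the range projection, `1 - (1 - y)^n` is unchanged by right multiplication by `r`, so
its value at `v` is `r v - (1 - y)^n (r v)`. -/
theorem tendsto_rangeApprox_apply {y : H →L[ℂ] H} (h₀ : 0 ≤ y) (h₁ : y ≤ 1) (v : H) :
    Filter.Tendsto (fun n => rangeApprox y n v) Filter.atTop (𝓝 (rangeProj y v)) := by
  have h := (tendsto_const_nhds (x := rangeProj y v)).sub
    (tendsto_one_sub_pow_apply h₀ h₁ (rangeProj_apply_mem_closure y v))
  rw [sub_zero] at h
  refine h.congr fun n => ?_
  conv_rhs => rw [← rangeApprox_mul_rangeProj h₀ n]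
  simp [rangeApprox]

theorem mul_mul_le_self_of_le_one {e a : H →L[ℂ] H} (he : IsStarProjection e) (ha : a ≤ 1) :
    e * a * e ≤ e := by
  simpa [he.isIdempotentElem.eq] using he.isSelfAdjoint.conjugate_le_conjugate ha

theorem rangeApprox_le_rangeProj {y : H →L[ℂ] H} (h₀ : 0 ≤ y) (h₁ : y ≤ 1) (n : ℕ) :
    rangeApprox y n ≤ rangeProj y := by
  have hr := rangeApprox_mul_rangeProj h₀ n
  have hl : rangeProj y * rangeApprox y n = rangeApprox y n := by
    rw [rangeApprox_eq_mul_sum, ← mul_assoc, rangeProj_mul_self]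
  have h := mul_mul_le_self_of_le_one (isStarProjection_rangeProj y) (rangeApprox_le_one h₁ n)
  rwa [hl, hr] at h

/-- Quadratic forms pass to the strong limit. This makes the range projection the supremum of the
approximants, as normality of the trace requires. -/
theorem rangeProj_le_of_rangeApprox_le {y b : H →L[ℂ] H} (h₀ : 0 ≤ y) (h₁ : y ≤ 1)
    (hb₀ : 0 ≤ b) (hb : ∀ n, rangeApprox y n ≤ b) : rangeProj y ≤ b := by
  rw [ContinuousLinearMap.le_def, ContinuousLinearMap.isPositive_def']
  refine ⟨(IsSelfAdjoint.of_nonneg hb₀).sub (isStarProjection_rangeProj y).isSelfAdjoint,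
    fun v => ?_⟩
  have ht : Filter.Tendsto (fun n => (b - rangeApprox y n).reApplyInnerSelf v) Filter.atTop
      (𝓝 ((b - rangeProj y).reApplyInnerSelf v)) := by
    simp only [ContinuousLinearMap.reApplyInnerSelf_apply, sub_apply]
    exact (RCLike.continuous_re.tendsto _).comp
      ((tendsto_const_nhds.sub (tendsto_rangeApprox_apply h₀ h₁ v)).inner tendsto_const_nhds)
  refine ge_of_tendsto' ht fun n => ?_
  exact ((ContinuousLinearMap.le_def _ _).1 (hb n)).2 v

/-- By `M'' = M`; this is how square roots are kept in `M`. -/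
theorem mem_of_commute {M : VonNeumannAlgebra H} {a b : H →L[ℂ] H} (ha : a ∈ M)
    (h : ∀ c, Commute a c → Commute b c) : b ∈ M := by
  rw [← VonNeumannAlgebra.commutant_commutant M, VonNeumannAlgebra.mem_commutant_iff]
  intro c hc
  exact (h c (VonNeumannAlgebra.mem_commutant_iff.1 hc a ha)).eq.symm

theorem one_sub_mem {M : VonNeumannAlgebra H} {y : H →L[ℂ] H} (hy : y ∈ M) : 1 - y ∈ M :=
  sub_mem (one_mem M) hy

theorem rangeApprox_mem {M : VonNeumannAlgebra H} {y : H →L[ℂ] H} (hy : y ∈ M) (n : ℕ) :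
    rangeApprox y n ∈ M :=
  one_sub_mem (pow_mem (one_sub_mem hy) n)

theorem sqrt_mem {M : VonNeumannAlgebra H} {y : H →L[ℂ] H} (hy : y ∈ M) : CFC.sqrt y ∈ M :=
  mem_of_commute hy fun c hc => by
    rw [CFC.sqrt]
    exact hc.cfcₙ_nnreal _

/-! ### Traces -/

variable {M : VonNeumannAlgebra H} {τ : posCone M →ₗ[ℝ≥0] ℝ≥0∞}

theorem trace_mono (τ : posCone M →ₗ[ℝ≥0] ℝ≥0∞) {x y : posCone M} (h : x ≤ y) : τ x ≤ τ y := by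
  let z : posCone M := ⟨y - x, sub_mem y.2.1 x.2.1, sub_nonneg.2 h⟩
  have : y = x + z := Subtype.ext (by simp [z])
  rw [this, map_add]
  exact le_self_add

/-- For `0 ≤ y ≤ 1` in `M`, a bound on the traces of all `1 - (1 - y) ^ n` bounds the trace of the
range projection of `y`. -/
theorem trace_rangeProj_le (hτ : IsFNSTrace M τ) {y : H →L[ℂ] H} (hy : y ∈ M) (h₀ : 0 ≤ y)
    (h₁ : y ≤ 1) {C : ℝ≥0∞}
    (hC : ∀ n, τ ⟨rangeApprox y n, rangeApprox_mem hy n, rangeApprox_nonneg h₀ h₁ n⟩ ≤ C) :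
    τ ⟨rangeProj y, rangeProj_mem hy, (isStarProjection_rangeProj y).nonneg⟩ ≤ C := by
  let f : ℕ → posCone M := fun n =>
    ⟨rangeApprox y n, rangeApprox_mem hy n, rangeApprox_nonneg h₀ h₁ n⟩
  have hf : Monotone f := fun _ _ h => rangeApprox_mono h₀ h₁ h
  refine (hτ.normal (Set.range f) _ (Set.range_nonempty f) hf.directed_le.directedOn_range
    ⟨?_, ?_⟩).2 ?_
  · rintro _ ⟨n, rfl⟩
    exact rangeApprox_le_rangeProj h₀ h₁ n
  · intro b hb
    exact rangeProj_le_of_rangeApprox_le h₀ h₁ b.2.2 fun n => hb ⟨n, rfl⟩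
  · rintro _ ⟨_, ⟨n, rfl⟩, rfl⟩
    exact hC n

/-- The intertwining `x f(x*x) = f(xx*) x` for `f(t) = (1 - t)^k`. -/
theorem mul_pow_one_sub_star_mul (x : H →L[ℂ] H) (k : ℕ) :
    x * (1 - star x * x) ^ k = (1 - x * star x) ^ k * x := by
  have h : SemiconjBy x (1 - star x * x) (1 - x * star x) := by
    simp [SemiconjBy, mul_sub, sub_mul, mul_assoc]
  exact (h.pow_right k).eq

/-- If `x ∈ M` is a contraction with `x p = x` for a projection `p`, then
`τ (1 - (1 - x x*) ^ n) ≤ τ p`. -/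
theorem trace_rangeApprox_le (hτ : IsFNSTrace M τ) {x : H →L[ℂ] H} (hx : x ∈ M) (p : Proj M)
    (hxp : x * p = x) (h₁ : x * star x ≤ 1) (h₁' : star x * x ≤ 1) (n : ℕ) :
    τ ⟨rangeApprox (x * star x) n, rangeApprox_mem (mul_mem hx (star_mem hx)) n,
      rangeApprox_nonneg (mul_star_self_nonneg x) h₁ n⟩ ≤ τ p.toPos := by
  set s : H →L[ℂ] H := ∑ k ∈ Finset.range n, (1 - star x * x) ^ k with hs
  have hs₀ : 0 ≤ s := Finset.sum_nonneg fun k _ => CStarAlgebra.pow_nonneg (sub_nonneg.2 h₁') k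
  have hxx : star x * x ∈ M := mul_mem (star_mem hx) hx
  have hsM : s ∈ M := sum_mem fun k _ => pow_mem (one_sub_mem hxx) k
  have hg : CFC.sqrt s * CFC.sqrt s = s := CFC.sqrt_mul_sqrt_self s hs₀
  have hgs : star (CFC.sqrt s) = CFC.sqrt s := (IsSelfAdjoint.of_nonneg (CFC.sqrt_nonneg s)).star_eq
  have hpx : (p : H →L[ℂ] H) * star x = star x := by
    simpa [p.2.2.isSelfAdjoint.star_eq] using congrArg star hxp
  have comm_sqrt : ∀ c, Commute (star x * x) c → Commute (CFC.sqrt s) c := fun c hc => by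
    have : Commute s c := Commute.sum_left _ _ _ fun k _ =>
      ((Commute.one_left c).sub_left hc).pow_left k
    rw [CFC.sqrt]
    exact this.cfcₙ_nnreal _
  have hgx : Commute (CFC.sqrt s) (star x * x) := comm_sqrt _ (Commute.refl _)
  have hgp : Commute (CFC.sqrt s) p := comm_sqrt _ <| by
    rw [commute_iff_eq, mul_assoc, hxp, ← mul_assoc, hpx]
  -- Since `s` is the geometric sum in `1 - x*x`, the element `z = x s^{1/2}` has `zz* = 1 - (1 -
  -- xx*)^n` and `z*z = 1 - (1 - x*x)^n`, so traciality can exchange the two.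
  set z : H →L[ℂ] H := x * CFC.sqrt s with hz
  have hzM : z ∈ M := mul_mem hx (sqrt_mem hsM)
  have hzz : z * star z = rangeApprox (x * star x) n := by
    rw [hz, star_mul, hgs, mul_assoc, ← mul_assoc (CFC.sqrt s), hg, ← mul_assoc, hs,
      Finset.mul_sum, rangeApprox_eq_mul_sum]
    simp_rw [mul_pow_one_sub_star_mul]
    rw [← Finset.sum_mul, mul_assoc]
    exact (Commute.sum_left _ _ _ fun k _ => (commute_one_sub_pow (x * star x) k).symm).eq
  have hzz' : star z * z = rangeApprox (star x * x) n := by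
    rw [hz, star_mul, hgs, mul_assoc, ← mul_assoc (star x), ← mul_assoc, hgx.eq, mul_assoc, hg,
      rangeApprox_eq_mul_sum]
  have hzp : z * p = z := by rw [hz, mul_assoc, hgp.eq, ← mul_assoc, hxp]
  have hpz : (p : H →L[ℂ] H) * star z = star z := by
    simpa [p.2.2.isSelfAdjoint.star_eq] using congrArg star hzp
  -- Compress `z*z ≤ 1` by `p`, which fixes `z*z` on both sides.
  have hle : star z * z ≤ p := by
    have h := mul_mul_le_self_of_le_one p.2.2 (hzz'.trans_le (rangeApprox_le_one h₁' n))
    rwa [← mul_assoc, hpz, mul_assoc, hzp] at h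
  calc _ = τ ⟨z * star z, mul_star_self_mem_posCone hzM⟩ := by congr 2; exact hzz.symm
    _ = τ ⟨star z * z, star_mul_self_mem_posCone hzM⟩ := (hτ.tracial z hzM).symm
    _ ≤ τ p.toPos := trace_mono τ hle

/-- Any two projections of `M` have a common upper bound in `Pr(M)` whose trace is at most the sum
of their traces. -/
theorem exists_proj_ge_trace_le_add (hτ : IsFNSTrace M τ) (p q : Proj M) :
    ∃ t : Proj M, p ≤ t ∧ q ≤ t ∧ τ t.toPos ≤ τ p.toPos + τ q.toPos := by
  -- This is the part of `p` not already covered by `q`. Its range projection is orthogonal to `q`,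
  -- and its right support lies under `p`.
  set x : H →L[ℂ] H := (1 - (q : H →L[ℂ] H)) * p with hx
  have hxM : x ∈ M := mul_mem (one_sub_mem q.2.1) p.2.1
  have hq' := q.2.2.one_sub
  have hsx : star x = p * (1 - (q : H →L[ℂ] H)) := by
    rw [hx, star_mul, hq'.isSelfAdjoint.star_eq, p.2.2.isSelfAdjoint.star_eq]
  have hxp : x * p = x := by rw [hx, mul_assoc, p.2.2.isIdempotentElem.eq]
  have h₁ : x * star x ≤ 1 := by
    have : x * star x = (1 - (q : H →L[ℂ] H)) * p * (1 - (q : H →L[ℂ] H)) := by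
      rw [hsx, ← mul_assoc, hxp, hx]
    rw [this]
    exact (mul_mul_le_self_of_le_one hq' p.2.2.le_one).trans hq'.le_one
  have h₁' : star x * x ≤ 1 := by
    have : star x * x = p * (1 - (q : H →L[ℂ] H)) * p := by
      rw [hsx, hx, mul_assoc, ← mul_assoc (1 - (q : H →L[ℂ] H)), hq'.isIdempotentElem.eq,
        mul_assoc]
    rw [this]
    exact (mul_mul_le_self_of_le_one p.2.2 hq'.le_one).trans p.2.2.le_one
  have hxxM : x * star x ∈ M := mul_mem hxM (star_mem hxM)
  set e : H →L[ℂ] H := rangeProj (x * star x) with he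
  have hep : IsStarProjection e := isStarProjection_rangeProj _
  have heM : e ∈ M := rangeProj_mem hxxM
  have heq : e * (q : H →L[ℂ] H) = 0 := by
    have h : x * star x * (q : H →L[ℂ] H) = 0 := by
      rw [hsx, mul_assoc, mul_assoc (p : H →L[ℂ] H), q.2.2.one_sub_mul_self, mul_zero, mul_zero]
    simpa using rangeProj_star_mul_eq_zero h
  have hqe : (q : H →L[ℂ] H) * e = 0 := by
    simpa [q.2.2.isSelfAdjoint.star_eq, hep.isSelfAdjoint.star_eq] using congrArg star heq
  -- From `(1 - e) x x* = 0` and the C*-identity applied to `(1 - e) x`.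
  have hex : e * x = x := by
    have h : ((1 - e) * x) * star ((1 - e) * x) = 0 := by
      have : (1 - e) * (x * star x) = 0 := by rw [sub_mul, one_mul, he, rangeProj_mul_self, sub_self]
      rw [star_mul, ← mul_assoc, mul_assoc (1 - e), this, zero_mul]
    have h' := (CStarRing.mul_star_self_eq_zero_iff _).1 h
    rw [sub_mul, one_mul, sub_eq_zero] at h'
    exact h'.symm
  let t : Proj M := ⟨q + e, add_mem q.2.1 heM, q.2.2.add hep hqe⟩
  refine ⟨t, ?_, ?_, ?_⟩
  · refine (IsStarProjection.le_iff_mul_eq_right p.2.2 t.2.2).2 ?_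
    -- Since `e q = 0`, `e p = e (1 - q) p = e x = x`; then `(q + e) p = q p + (1 - q) p = p`.
    have : e * (p : H →L[ℂ] H) = x := by
      rw [← hex, hx, ← mul_assoc, mul_sub, heq]; simp
    change ((q : H →L[ℂ] H) + e) * p = p
    rw [add_mul, this, hx, sub_mul, one_mul, add_sub_cancel]
  · refine (IsStarProjection.le_iff_mul_eq_right q.2.2 t.2.2).2 ?_
    change ((q : H →L[ℂ] H) + e) * q = q
    rw [add_mul, heq, q.2.2.isIdempotentElem.eq, add_zero]
  · let e' : Proj M := ⟨e, heM, hep⟩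
    have ht : t.toPos = q.toPos + e'.toPos := rfl
    rw [ht, map_add, add_comm]
    gcongr
    exact trace_rangeProj_le hτ hxxM (mul_star_self_nonneg x) h₁
      (trace_rangeApprox_le hτ hxM p hxp h₁ h₁')

/-! ### The coarse structure of a trace -/

theorem IsConstrained.comp {φ ψ : Proj M → Proj M} (hφ : IsConstrained τ φ)
    (hψ : IsConstrained τ ψ) : IsConstrained τ (φ ∘ ψ) := by
  obtain ⟨c, hc⟩ := hφ
  obtain ⟨d, hd⟩ := hψ
  refine ⟨c * d, fun q => ?_⟩
  calc τ (φ (ψ q)).toPos ≤ c * τ (ψ q).toPos := hc _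
    _ ≤ c * (d * τ q.toPos) := by gcongr; exact hd q
    _ = _ := by push_cast; ring

theorem isConstrained_id : IsConstrained τ (id : Proj M → Proj M) := ⟨1, fun q => by simp⟩

theorem IsConstrained.exists_ge (hτ : IsFNSTrace M τ) {φ ψ : Proj M → Proj M}
    (hφ : IsConstrained τ φ) (hψ : IsConstrained τ ψ) :
    ∃ χ, IsConstrained τ χ ∧ (∀ q, φ q ≤ χ q) ∧ ∀ q, ψ q ≤ χ q := by
  obtain ⟨c, hc⟩ := hφ
  obtain ⟨d, hd⟩ := hψ
  choose χ h₁ h₂ h₃ using fun q => exists_proj_ge_trace_le_add hτ (φ q) (ψ q)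
  refine ⟨χ, ⟨c + d, fun q => (h₃ q).trans ?_⟩, h₁, h₂⟩
  rw [ENNReal.coe_add, add_mul]
  exact add_le_add (hc q) (hd q)

theorem isQuantumCoarseStructure_traceFamily (hτ : IsFNSTrace M τ) :
    IsQuantumCoarseStructure M (traceFamily M τ) where
  isQuantumRelation V hV := hV.1
  commutant_mem := ⟨isQuantumRelation_commutant M, id, id, isConstrained_id, isConstrained_id,
    fun _ ha => ⟨commutant_subset_relOf_id M ha,
      commutant_subset_relOf_id M (star_mem (S := VonNeumannAlgebra H) ha)⟩⟩
  subset_mem V₁ hV₁ V₂ hV₂ h := by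
    obtain ⟨-, φ, ψ, hφ, hψ, hV⟩ := hV₁
    exact ⟨hV₂, φ, ψ, hφ, hψ, h.trans hV⟩
  star_mem V hV := by
    obtain ⟨hV, φ, ψ, hφ, hψ, h⟩ := hV
    refine ⟨hV.star, ψ, φ, hψ, hφ, fun a ha => ?_⟩
    have := h ha
    exact ⟨by simpa using this.2, this.1⟩
  add_mem V₁ hV₁ V₂ hV₂ := by
    obtain ⟨hV₁, φ₁, ψ₁, hφ₁, hψ₁, h₁⟩ := hV₁
    obtain ⟨hV₂, φ₂, ψ₂, hφ₂, hψ₂, h₂⟩ := hV₂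
    obtain ⟨φ, hφ, hφ', hφ''⟩ := hφ₁.exists_ge hτ hφ₂
    obtain ⟨ψ, hψ, hψ', hψ''⟩ := hψ₁.exists_ge hτ hψ₂
    refine ⟨isQuantumRelation_add hV₁ hV₂, φ, ψ, hφ, hψ,
      weakStarClosure_subset ?_ (isQuantumRelation_relOf₂ φ ψ).isClosed⟩
    rintro _ ⟨a, ha, b, hb, rfl⟩
    exact (isQuantumRelation_relOf₂ φ ψ).add_mem a
      ⟨relOf_mono hφ' (h₁ ha).1, relOf_mono hψ' (h₁ ha).2⟩ b
      ⟨relOf_mono hφ'' (h₂ hb).1, relOf_mono hψ'' (h₂ hb).2⟩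
  mul_mem V₁ hV₁ V₂ hV₂ := by
    obtain ⟨hV₁, φ₁, ψ₁, hφ₁, hψ₁, h₁⟩ := hV₁
    obtain ⟨hV₂, φ₂, ψ₂, hφ₂, hψ₂, h₂⟩ := hV₂
    -- The maps `ψ` compose in reverse order because `(ab)* = b* a*`.
    have hR := isQuantumRelation_relOf₂ (φ₁ ∘ φ₂) (ψ₂ ∘ ψ₁)
    refine ⟨isQuantumRelation_mul hV₁ hV₂, φ₁ ∘ φ₂, ψ₂ ∘ ψ₁, hφ₁.comp hφ₂, hψ₂.comp hψ₁,
      weakStarClosure_subset (Submodule.span_le (p := hR.toSubmodule).2 ?_) hR.isClosed⟩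
    rintro _ ⟨a, ha, b, hb, rfl⟩
    refine ⟨mul_mem_relOf (h₁ ha).1 (h₂ hb).1, ?_⟩
    rw [Set.mem_star, star_mul]
    exact mul_mem_relOf (h₂ hb).2 (h₁ ha).2

theorem isOperatorReflexive_traceFamily : IsOperatorReflexive (traceFamily M τ) := by
  rintro V ⟨hV, φ, ψ, hφ, hψ, h⟩
  refine ⟨isQuantumRelation_orc hV, φ, ψ, hφ, hψ, fun a ha =>
    ⟨orc_relOf (fun b hb => (h hb).1) ha, ?_⟩⟩
  refine orc_relOf (V := star V) (fun b hb => ?_) (star_orc V (by simpa using ha))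
  simpa using (h hb).2

theorem algRoe_traceFamily :
    algRoe (traceFamily M τ) = {a : H →L[ℂ] H | ∃ c : ℝ≥0, ∀ q : Proj M,
      τ (leftSupport M (a * q)).toPos ≤ c * τ q.toPos ∧
      τ (leftSupport M (star a * q)).toPos ≤ c * τ q.toPos} := by
  ext a
  simp only [algRoe, Set.mem_iUnion, Set.mem_ofPred_eq]
  constructor
  · rintro ⟨V, ⟨-, φ, ψ, ⟨c, hc⟩, ⟨d, hd⟩, h⟩, ha⟩
    refine ⟨max c d, fun q => ⟨?_, ?_⟩⟩
    · refine (trace_mono τ ((h ha).1 q)).trans ((hc q).trans ?_)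
      gcongr
      exact le_max_left c d
    · refine (trace_mono τ ((h ha).2 q)).trans ((hd q).trans ?_)
      gcongr
      exact le_max_right c d
  · rintro ⟨c, hc⟩
    -- The pointwise least maps whose relation contains `a`; the hypothesis is exactly that both are
    -- constrained.
    refine ⟨relOf₂ (fun q => leftSupport M (a * q)) (fun q => leftSupport M (star a * q)),
      ⟨isQuantumRelation_relOf₂ _ _, _, _, ⟨c, fun q => (hc q).1⟩, ⟨c, fun q => (hc q).2⟩,
        subset_rfl⟩, fun q => le_rfl, fun q => le_rfl⟩

end QuantumCoarse

end

open QuantumCoarse in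
theorem theorem5p6 {H : Type*} [NormedAddCommGroup H] [InnerProductSpace ℂ H] [CompleteSpace H]
    (M : VonNeumannAlgebra H) (τ : posCone M →ₗ[ℝ≥0] ℝ≥0∞) (hτ : IsFNSTrace M τ) :
    IsQuantumCoarseStructure M (traceFamily M τ) ∧
    IsOperatorReflexive (traceFamily M τ) ∧
    algRoe (traceFamily M τ) =
      {a : H →L[ℂ] H | ∃ c : ℝ≥0, ∀ q : Proj M,
        τ (leftSupport M (a * q)).toPos ≤ c * τ q.toPos ∧
        τ (leftSupport M (star a * q)).toPos ≤ c * τ q.toPos} := by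
  exact ⟨isQuantumCoarseStructure_traceFamily hτ, isOperatorReflexive_traceFamily,
    algRoe_traceFamily⟩
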